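/- Let $C(\mathbb{R}^2)$ be the space of continuous functions $F:\mathbb{R}^2\to\mathbb{R}$ with the topology of uniform convergence on compact sets. Let $\mathcal{G}$ be the set of all $(F,x,y)\in C(\mathbb{R}^2)\times\mathbb{R}^2$ such that the Cauchy problem $\varphi'(t)=F(t,\varphi(t))$, $\varphi(x)=y$ has a global solution, i.e. a solution $\varphi$ defined on all of $\mathbb{R}$. For $(x,y)\in\mathbb{R}^2$ let $\mathcal{G}_{(x,y)}=\{F\in C(\mathbb{R}^2) : (F,x,y)\in\mathcal{G}\}$. A subset $S$ of a topological space $X$ is called $\Sigma^0_4$-hard if for every zero-dimensional Polish space $Y$ and every $\Sigma^0_4$ set $B\subseteq Y$ there is a continuous map $f:Y\to X$ with $f^{-1}(S)=B$. Then: 1. $\mathcal{G}$ is $\Sigma^0_4$-hard. 2. There is a continuous map $\alpha\mapsto F_\alpha$ from $2^{\mathbb{N}\times\mathbb{N}}$ (with the product topology, $2=\{0,1\}$ discrete) to $C(\mathbb{R}^2)$ such that for every $\alpha\in 2^{\mathbb{N}\times\mathbb{N}}$ $$(F_\alpha,-1,0)\in\mathcal{G}\iff \text{for all but finitely many } n,\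 \text{for all but finitely many } m,\ \alpha(n,m)=0.$$ 3. For every $(x,y)\in\mathbb{R}^2$ the set $\mathcal{G}_{(x,y)}$ is $\Sigma^0_4$-hard. -/

import Mathlib

open Filter Topology

universe u v

/-- The Borel class of finite level `n`: `IsSigma0 n S` says that `S` is a `Σ⁰ₙ` subset of `X`.
`Σ⁰₁` sets are the open sets, and a set is `Σ⁰ₙ₊₁` if it is a countable union of sets whose
complements are `Σ⁰ₙ` (that is, of `Π⁰ₙ` sets). This is the standard hierarchy on metrizable spaces,
the only spaces to which it is applied. Level `0` is not used. -/
def IsSigma0 {X : Type v} [TopologicalSpace X] : ℕ → Set X → Prop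
  | 0, _ => False
  | 1, S => IsOpen S
  | n + 2, S => ∃ A : ℕ → Set X, (∀ i, IsSigma0 (n + 1) (A i)ᶜ) ∧ S = ⋃ i, A i

/-- A space is zero-dimensional if its clopen sets form a basis of the topology. -/
def IsZeroDimensional (Y : Type u) [TopologicalSpace Y] : Prop :=
  TopologicalSpace.IsTopologicalBasis {s : Set Y | IsClopen s}

/-- `S ⊆ X` is `Σ⁰ₙ`-hard: every `Σ⁰ₙ` subset of every zero-dimensional Polish space is the preimage
of `S` under a continuous map (it is Wadge reducible to `S`). -/
def IsSigma0Hard {X : Type v} [TopologicalSpace X] (n : ℕ) (S : Set X) : Prop :=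
  ∀ (Y : Type u) [TopologicalSpace Y] [PolishSpace Y], IsZeroDimensional Y →
    ∀ B : Set Y, IsSigma0 n B → ∃ f : Y → X, Continuous f ∧ f ⁻¹' S = B

/-- `φ : ℝ → ℝ` is a global solution, i.e. one defined on the whole of `ℝ`, of the Cauchy problem
`φ' = F (t, φ)`, `φ x = y`. -/
def IsGlobalSolution (F : C(ℝ × ℝ, ℝ)) (x y : ℝ) (φ : ℝ → ℝ) : Prop :=
  φ x = y ∧ ∀ t : ℝ, HasDerivAt φ (F (t, φ t)) t

/-- The set `𝒢` of the Cauchy problems `(F, x, y)` that have a global solution. The space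
`C(ℝ × ℝ, ℝ)` carries the compact-open topology, i.e. that of uniform convergence on compact sets. -/
def globalCauchy : Set (C(ℝ × ℝ, ℝ) × ℝ × ℝ) :=
  {p | ∃ φ : ℝ → ℝ, IsGlobalSolution p.1 p.2.1 p.2.2 φ}

/-- The section `𝒢_{(x,y)}` of `𝒢` at the initial condition `(x, y)`. -/
def globalCauchyAt (x y : ℝ) : Set C(ℝ × ℝ, ℝ) :=
  {F | (F, x, y) ∈ globalCauchy}

/-!
# Cauchy problems with a global solution form a `Σ⁰₄`-hard set

Every `Σ⁰₄` set `B` in a zero-dimensional Polish space is a continuous preimage of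
`{α | ∀ᶠ n, ∀ᶠ m, α (n, m) = 0}`. Its complement is a countable intersection of countable unions of
`Gδ` sets, and these unions can be made disjoint (`exists_disjoint_isGδ`). A point then lies in
infinitely many of the finite intersections of pieces, one piece from each of the first `k` unions,
if and only if it lies in all the unions (`exists_seq_infinite_of_disjoint`). The same argument
turns each `Gδ` set into "infinitely often in a clopen set".

It remains to encode `α` by a field `F_α`. A solution has two kinds of free choice, both due to
non-uniqueness. In the lower half-plane, a solution from `(-1, 0)` branches off downwards, blowing
up if it leaves `0` too early, and so can reach any depth at time `0`; for `t ≥ 0` it then returns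
to height `0` at a finite time which it can postpone at will, but not avoid (`exists_nonneg`). In
the upper half-plane, it meets the `n`-th window `[2πn, 2π(n + 1)]`, at whose beginning it can rise
from `0` to any height `M` and at whose end it can go back to `0`. In the middle, it obeys
`u' = (-cos t) (trap u + drift u)`, where `trap` vanishes just at the natural numbers (for `u ≥ 0`),
`∫₀^∞ 1 / trap` is less than the time available, and `drift` is positive on `[0, m + 1)` for each
`m` with `α (n, m) = 1` and is otherwise zero. If `α (n, m) = 0` for all `m ≥ M`, the solution can
rest at the height `M`; if there is no such `M`, every solution blows up
(`eventually_eq_zero_of_nonneg`). So a global solution exists if and only if almost all windows can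
be passed: the choice of the return time gives the outer "for almost all `n`", that of the heights
the inner "for almost all `m`". The explicit solutions (`exists_isGlobalSolution`) are built from
`tan²`, which solves `u' = 2 √u (1 + u)`, as does `0`.

Hardness at an arbitrary initial condition follows by translation.
-/

/-! ### Reduction of `Σ⁰₄` sets to double "for all but finitely many" -/

/-- If each `⋃ j, U l j` is a disjoint union, then `y` lies in all of them if and only if it
satisfies infinitely many finite lists `j₀, …, jₖ`, in the sense that `y ∈ U i jᵢ` for all `i ≤ k`:
by disjointness, at most one list of each length is satisfied. -/
theorem forall_mem_iUnion_iff_infinite_lists {Y J : Type*} {U : ℕ → J → Set Y}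
    (hU : ∀ l, Pairwise fun i j => Disjoint (U l i) (U l j)) (y : Y) :
    (∀ l, y ∈ ⋃ j, U l j) ↔
      {s : List J | ∀ i (h : i < s.length), y ∈ U i s[i]}.Infinite := by
  constructor
  · intro h
    simp only [Set.mem_iUnion] at h
    choose j hj using h
    refine Set.infinite_of_injective_forall_mem (f := fun k => (List.range k).map j) ?_ ?_
    · intro a b hab
      simpa using congrArg List.length hab
    · intro k i hi
      simpa using hj i
  · intro h l
    have hinj : Set.InjOn List.length {s : List J | ∀ i (h : i < s.length), y ∈ U i s[i]} := by
      intro s hs t ht hst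
      refine List.ext_getElem hst fun i hi hi' => ?_
      by_contra hne
      exact Set.disjoint_left.1 (hU i hne) (hs i hi) (ht i hi')
    obtain ⟨_, ⟨s, hs, rfl⟩, hl⟩ := (h.image hinj).exists_gt l
    exact Set.mem_iUnion.2 ⟨_, hs l hl⟩

/-- A countable intersection of disjoint countable unions of sets in a class closed under finite
intersections is the set of points which lie in infinitely many members of a sequence of sets of
this class. -/
theorem exists_seq_infinite_of_disjoint {Y J : Type*} [Denumerable J] {P : Set Y → Prop}
    (hP : ∀ (k : ℕ) (A : Fin k → Set Y), (∀ i, P (A i)) → P (⋂ i, A i))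
    {U : ℕ → J → Set Y} (hPU : ∀ l j, P (U l j))
    (hU : ∀ l, Pairwise fun i j => Disjoint (U l i) (U l j)) :
    ∃ V : ℕ → Set Y, (∀ n, P (V n)) ∧
      ∀ y, (∀ l, y ∈ ⋃ j, U l j) ↔ ∃ᶠ n in atTop, y ∈ V n := by
  refine ⟨fun n => ⋂ i : Fin ((Denumerable.eqv (List J)).symm n).length,
    U i ((Denumerable.eqv (List J)).symm n)[i], fun n => hP _ _ fun i => hPU _ _, fun y => ?_⟩
  rw [forall_mem_iUnion_iff_infinite_lists hU, Nat.frequently_atTop_iff_infinite,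
    ← Set.infinite_image_iff (Denumerable.eqv (List J)).injective.injOn]
  refine iff_of_eq (congrArg _ ?_)
  ext n
  rw [Equiv.image_eq_preimage_symm]
  simp [Fin.forall_iff]

theorem IsZeroDimensional.exists_disjoint_clopen {Y : Type*} [TopologicalSpace Y]
    [SecondCountableTopology Y] (hY : IsZeroDimensional Y) {O : Set Y} (hO : IsOpen O) :
    ∃ U : ℕ → Set Y, (∀ j, IsClopen (U j)) ∧ (Pairwise fun i j => Disjoint (U i) (U j)) ∧
      O = ⋃ j, U j := by
  obtain ⟨T, hT, rfl⟩ := hY.open_eq_sUnion hO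
  obtain ⟨T', hT'c, hT'T, hT'⟩ :=
    TopologicalSpace.isOpen_sUnion_countable T fun s hs => (hT hs).isOpen
  obtain ⟨C, hC⟩ := (hT'c.insert ∅).exists_eq_range (Set.insert_nonempty _ _)
  have hclopen : ∀ j, IsClopen (C j) := by
    intro j
    have : C j ∈ insert ∅ T' := hC ▸ Set.mem_range_self j
    rcases this with h | h
    · rw [h]; exact isClopen_empty
    · exact hT (hT'T h)
  refine ⟨disjointed C, fun j => disjointedRec (fun _ _ h => h.diff (hclopen _)) (hclopen j),
    disjoint_disjointed C, ?_⟩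
  rw [iUnion_disjointed, ← Set.sUnion_range, ← hC, Set.sUnion_insert, Set.empty_union, hT']

/-- A countable union of `Gδ` sets in a metrizable space is a countable disjoint union of
`Gδ` sets: subtracting the earlier sets leaves intersections of `Gδ` and `Fσ` sets, and an `Fσ` set
is a disjoint union of differences of closed sets. -/
theorem exists_disjoint_isGδ {Y : Type*} [TopologicalSpace Y]
    [TopologicalSpace.MetrizableSpace Y] {A : ℕ → Set Y} (hA : ∀ j, IsGδ (A j)) :
    ∃ U : ℕ × ℕ → Set Y, (∀ p, IsGδ (U p)) ∧ (Pairwise fun i j => Disjoint (U i) (U j)) ∧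
      ⋃ j, A j = ⋃ p, U p := by
  let := TopologicalSpace.metrizableSpaceMetric Y
  have hlt : ∀ j, IsGδ (⋃ i : Fin j, A i) := fun j => IsGδ.iUnion fun i => hA i
  choose O hO hOeq using fun j => (isGδ_iff_eq_iInter_nat.1 (hlt j))
  have hdiff : ∀ j, disjointed A j = A j ∩ ⋃ l, (O j l)ᶜ := by
    intro j
    rw [← Set.compl_iInter, ← hOeq]
    ext y
    simp [disjointed_eq_inter_compl, Fin.forall_iff]
  refine ⟨fun p => A p.1 ∩ disjointed (fun l => (O p.1 l)ᶜ) p.2, ?_, ?_, ?_⟩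
  · intro p
    refine (hA _).inter (disjointedRec (p := IsGδ) (fun t i h => ?_) (hO p.1 p.2).isClosed_compl.isGδ)
    rw [Set.sdiff_eq, compl_compl]
    exact h.inter (hO p.1 i).isGδ
  · have hsub : ∀ p : ℕ × ℕ, A p.1 ∩ disjointed (fun l => (O p.1 l)ᶜ) p.2 ⊆ disjointed A p.1 := by
      intro p
      rw [hdiff]
      exact Set.inter_subset_inter_right _
        ((disjointed_subset _ _).trans (Set.subset_iUnion (fun l => (O p.1 l)ᶜ) p.2))
    rintro ⟨j, l⟩ ⟨j', l'⟩ hne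
    rcases eq_or_ne j j' with rfl | hj
    · have hl : l ≠ l' := fun h => hne (by rw [h])
      exact (disjoint_disjointed _ hl).mono Set.inter_subset_right Set.inter_subset_right
    · exact (disjoint_disjointed A hj).mono (hsub (j, l)) (hsub (j', l'))
  · rw [← iUnion_disjointed, Set.iUnion_prod']
    refine Set.iUnion_congr fun j => ?_
    dsimp only
    rw [hdiff, ← Set.inter_iUnion, iUnion_disjointed]

/-- `{α | ∀ᶠ n, ∀ᶠ m, α (n, m) = 0}` is `Σ⁰₄`-hard. -/
theorem IsSigma0.exists_continuous_eventually {Y : Type*} [TopologicalSpace Y] [PolishSpace Y]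
    (hY : IsZeroDimensional Y) {B : Set Y} (hB : IsSigma0 4 B) :
    ∃ f : Y → (ℕ × ℕ → Fin 2), Continuous f ∧
      ∀ y, y ∈ B ↔ ∀ᶠ n in atTop, ∀ᶠ m in atTop, f y (n, m) = 0 := by
  obtain ⟨A, hA, rfl⟩ := hB
  choose A₂ hA₂ hA₂eq using hA
  choose A₃ hA₃ hA₃eq using hA₂
  have hGδ : ∀ i j, IsGδ (A₂ i j) := by
    intro i j
    rw [← compl_compl (A₂ i j), hA₃eq, Set.compl_iUnion]
    exact IsGδ.iInter_of_isOpen fun l => hA₃ i j l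
  choose U hU hUd hUeq using fun i => exists_disjoint_isGδ (hGδ i)
  obtain ⟨V, hV, hVmem⟩ := exists_seq_infinite_of_disjoint (P := IsGδ)
    (fun k A h => IsGδ.iInter h) hU hUd
  choose O hO hOeq using fun n => isGδ_iff_eq_iInter_nat.1 (hV n)
  choose C hC hCd hCeq using fun n l => hY.exists_disjoint_clopen (hO n l)
  choose W hW hWmem using fun n => exists_seq_infinite_of_disjoint (P := IsClopen)
    (fun k A h => ⟨isClosed_iInter fun i => (h i).1, isOpen_iInter_of_finite fun i => (h i).2⟩)
    (hC n) (hCd n)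
  classical
  refine ⟨fun y p => if y ∈ W p.1 p.2 then 1 else 0, ?_, fun y => ?_⟩
  · refine continuous_pi fun p => ?_
    refine continuous_if ?_ continuousOn_const continuousOn_const
    intro a ha
    exact absurd ha (by simp [(hW p.1 p.2).frontier_eq])
  · have h1 : y ∈ ⋃ i, A i ↔ ¬ ∀ i, y ∈ ⋃ p, U i p := by
      simp only [← hUeq, ← hA₂eq, Set.mem_iUnion, Set.mem_compl_iff, not_forall, not_not]
    have h2 : ∀ n, y ∈ V n ↔ ∃ᶠ m in atTop, y ∈ W n m := by
      intro n
      rw [← hWmem, hOeq, Set.mem_iInter]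
      simp only [← hCeq]
    rw [h1, hVmem, not_frequently]
    refine eventually_congr (Eventually.of_forall fun n => ?_)
    rw [h2, not_frequently]
    simp

/-! ### The vector field -/

namespace GlobalCauchy

open Real

/-- The branching nonlinearity `2 √x (1 + x)`. The functions `0` and `tan²` both solve `x' = f x`
from `0`, and the second one blows up. -/
noncomputable def branching (x : ℝ) : ℝ := 2 * √x * (1 + x)

/-- The trapping nonlinearity: it vanishes at the natural numbers and below `0`, and its reciprocal
has a finite integral over `[0, ∞)`. -/
noncomputable def trap (u : ℝ) : ℝ := 5 * 2 ^ u * √|sin (π * max u 0)|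

/-- A continuous function equal to `1` on `[2πn + π/2, 2πn + 3π/2]` and to `0` outside
`[2πn, 2π(n + 1)]`. -/
noncomputable def window (n : ℕ) (t : ℝ) : ℝ :=
  max 0 (min 1 (2 - |t - (2 * n + 1) * π| * (2 / π)))

/-- A continuous function with values in `[0, 1]`, positive exactly on `(-1, m + 1)`. -/
noncomputable def cutoff (m : ℕ) (u : ℝ) : ℝ := max 0 (min 1 (min (m + 1 - u) (u + 1)))

/-- The term of the drift which is switched on by the bit `α (n, m)`: it acts in the `n`-th time
window, below the height `m + 1`. -/
noncomputable def driftTerm (α : ℕ × ℕ → Fin 2) (t u : ℝ) (p : ℕ × ℕ) : ℝ :=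
  (α p : ℕ) * ((1 / 2) ^ p.1 * (1 / 2) ^ p.2) * (window p.1 t * cutoff p.2 u)

/-- The upward drift caused by the bits of `α`. -/
noncomputable def drift (α : ℕ × ℕ → Fin 2) (t u : ℝ) : ℝ := ∑' p, driftTerm α t u p

/-- The field as a function of `α`, `t` and `u`. For `t ≤ 0`, solutions branch off downwards from
`0`. For `t ≥ 0`, solutions below `0` return to `0`, those above `0` branch off upwards when
`cos t, sin t > 0` and back when `cos t > 0 > sin t`, and are subject to trap and drift when
`cos t < 0`. -/
noncomputable def fieldFun (α : ℕ × ℕ → Fin 2) (t u : ℝ) : ℝ :=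
  4 * min t 0 * branching (max (-u) 0) + 4 * max t 0 * √(max (-u) 0)
    + π * (max (cos t) 0 * sin t) * branching (max u 0)
    + max (-cos t) 0 * (trap u + drift α t u)

theorem window_nonneg (n : ℕ) (t : ℝ) : 0 ≤ window n t := le_max_left _ _

theorem window_le_one (n : ℕ) (t : ℝ) : window n t ≤ 1 :=
  max_le zero_le_one (min_le_left _ _)

theorem cutoff_nonneg (m : ℕ) (u : ℝ) : 0 ≤ cutoff m u := le_max_left _ _

theorem cutoff_le_one (m : ℕ) (u : ℝ) : cutoff m u ≤ 1 :=
  max_le zero_le_one (min_le_left _ _)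

theorem trap_nonneg (u : ℝ) : 0 ≤ trap u := by unfold trap; positivity

theorem branching_zero : branching 0 = 0 := by simp [branching]

theorem cutoff_eq_zero_of_le {m : ℕ} {u : ℝ} (h : (m : ℝ) + 1 ≤ u) : cutoff m u = 0 :=
  max_eq_left <| (min_le_right _ _).trans <| (min_le_left _ _).trans (by linarith)

theorem cutoff_eq_zero_of_le_neg_one {m : ℕ} {u : ℝ} (h : u ≤ -1) : cutoff m u = 0 :=
  max_eq_left <| (min_le_right _ _).trans <| (min_le_right _ _).trans (by linarith)

theorem cutoff_pos {m : ℕ} {u : ℝ} (h0 : 0 ≤ u) (h : u ≤ m) : 0 < cutoff m u :=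
  lt_max_of_lt_right <| lt_min one_pos <| lt_min (by linarith) (by linarith)

theorem window_eq_one {n : ℕ} {t : ℝ} (h : |t - (2 * n + 1) * π| ≤ π / 2) : window n t = 1 := by
  have : |t - (2 * n + 1) * π| * (2 / π) ≤ 1 := by
    calc _ ≤ π / 2 * (2 / π) := by gcongr
      _ = 1 := by field_simp
  rw [window, min_eq_left (by linarith), max_eq_right zero_le_one]

theorem window_eq_zero {n : ℕ} {t : ℝ} (h : π ≤ |t - (2 * n + 1) * π|) : window n t = 0 := by
  have : 2 ≤ |t - (2 * n + 1) * π| * (2 / π) := by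
    calc (2 : ℝ) = π * (2 / π) := by field_simp
      _ ≤ _ := by gcongr
  exact max_eq_left ((min_le_right _ _).trans (by linarith))

theorem window_eq_zero_of_nonpos {n : ℕ} {t : ℝ} (h : t ≤ 0) : window n t = 0 := by
  refine window_eq_zero (le_trans ?_ (neg_le_abs _))
  nlinarith [pi_pos, (Nat.cast_nonneg n : (0 : ℝ) ≤ n)]

/-- On the support of `cos⁻`, only one window is open. -/
theorem window_eq_ite {n k : ℕ} {t : ℝ} (h : |t - (2 * n + 1) * π| ≤ π / 2) :
    window k t = if k = n then 1 else 0 := by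
  split_ifs with hk
  · rw [hk, window_eq_one h]
  · refine window_eq_zero ?_
    have h1 : (1 : ℝ) ≤ |(n : ℝ) - k| := by
      have : (1 : ℤ) ≤ |(n : ℤ) - k| := Int.one_le_abs (by omega)
      exact_mod_cast this
    have h2 : 2 * π * |(n : ℝ) - k| = |(2 * n + 1) * π - (2 * k + 1) * π| := by
      rw [show (2 * (n : ℝ) + 1) * π - (2 * k + 1) * π = 2 * π * (n - k) by ring, abs_mul,
        abs_of_pos two_pi_pos]
    have h3 : |(2 * n + 1) * π - (2 * k + 1) * π| ≤
        |(2 * n + 1) * π - t| + |t - (2 * k + 1) * π| := abs_sub_le _ _ _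
    rw [abs_sub_comm] at h
    nlinarith [pi_pos]

theorem driftTerm_nonneg (α : ℕ × ℕ → Fin 2) (t u : ℝ) (p : ℕ × ℕ) : 0 ≤ driftTerm α t u p := by
  have := window_nonneg p.1 t
  have := cutoff_nonneg p.2 u
  unfold driftTerm
  positivity

theorem driftTerm_le (α : ℕ × ℕ → Fin 2) (t u : ℝ) (p : ℕ × ℕ) :
    driftTerm α t u p ≤ (1 / 2) ^ p.1 * (1 / 2) ^ p.2 := by
  have h1 : ((α p : ℕ) : ℝ) ≤ 1 := by exact_mod_cast Nat.lt_succ_iff.1 (α p).2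
  have h2 : window p.1 t * cutoff p.2 u ≤ 1 :=
    mul_le_one₀ (window_le_one _ _) (cutoff_nonneg _ _) (cutoff_le_one _ _)
  have h3 : (0 : ℝ) ≤ (1 / 2) ^ p.1 * (1 / 2) ^ p.2 := by positivity
  calc driftTerm α t u p ≤ 1 * ((1 / 2) ^ p.1 * (1 / 2) ^ p.2) * 1 := by
        unfold driftTerm
        have := window_nonneg p.1 t
        have := cutoff_nonneg p.2 u
        gcongr
    _ = _ := by ring

theorem summable_weights : Summable fun p : ℕ × ℕ => ((1 / 2 : ℝ) ^ p.1 * (1 / 2) ^ p.2) :=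
  summable_geometric_two.mul_of_nonneg summable_geometric_two
    (fun _ => by positivity) fun _ => by positivity

theorem summable_driftTerm (α : ℕ × ℕ → Fin 2) (t u : ℝ) : Summable (driftTerm α t u) :=
  .of_nonneg_of_le (driftTerm_nonneg α t u) (driftTerm_le α t u) summable_weights

theorem drift_nonneg (α : ℕ × ℕ → Fin 2) (t u : ℝ) : 0 ≤ drift α t u :=
  tsum_nonneg (driftTerm_nonneg α t u)

theorem continuous_branching : Continuous branching := by unfold branching; fun_prop

theorem continuous_trap : Continuous trap := by
  have : Continuous fun u : ℝ => (2 : ℝ) ^ u := continuous_const_rpow two_ne_zero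
  unfold trap
  fun_prop

theorem continuous_window (n : ℕ) : Continuous (window n) := by unfold window; fun_prop

theorem continuous_cutoff (m : ℕ) : Continuous (cutoff m) := by unfold cutoff; fun_prop

theorem continuous_drift :
    Continuous fun x : (ℕ × ℕ → Fin 2) × ℝ × ℝ => drift x.1 x.2.1 x.2.2 := by
  refine continuous_tsum (fun p => ?_) summable_weights fun p x => ?_
  · have h1 : Continuous fun x : (ℕ × ℕ → Fin 2) × ℝ × ℝ => ((x.1 p : ℕ) : ℝ) :=
      (continuous_of_discreteTopology (f := fun i : Fin 2 => ((i : ℕ) : ℝ))).comp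
        ((continuous_apply p).comp continuous_fst)
    have h2 : Continuous fun x : (ℕ × ℕ → Fin 2) × ℝ × ℝ => window p.1 x.2.1 :=
      (continuous_window p.1).comp (by fun_prop)
    have h3 : Continuous fun x : (ℕ × ℕ → Fin 2) × ℝ × ℝ => cutoff p.2 x.2.2 :=
      (continuous_cutoff p.2).comp (by fun_prop)
    unfold driftTerm
    fun_prop
  · rw [Real.norm_of_nonneg (driftTerm_nonneg _ _ _ _)]
    exact driftTerm_le _ _ _ _

theorem continuous_fieldFun :
    Continuous fun x : (ℕ × ℕ → Fin 2) × ℝ × ℝ => fieldFun x.1 x.2.1 x.2.2 := by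
  have h1 := continuous_drift
  have h2 := continuous_trap
  have h3 := continuous_branching
  unfold fieldFun
  fun_prop

/-- The family of fields `F_α`. -/
noncomputable def field : C(ℕ × ℕ → Fin 2, C(ℝ × ℝ, ℝ)) :=
  ContinuousMap.curry ⟨_, continuous_fieldFun⟩

theorem field_apply (α : ℕ × ℕ → Fin 2) (t u : ℝ) : field α (t, u) = fieldFun α t u := rfl

end GlobalCauchy

/-! ### Blow-up -/

namespace GlobalCauchy

open Real MeasureTheory

theorem fieldFun_of_neg {α : ℕ × ℕ → Fin 2} {t u : ℝ} (ht : 0 ≤ t) (hu : u < 0) :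
    4 * t * √(-u) ≤ fieldFun α t u := by
  have h := mul_nonneg (le_max_right (-cos t) 0) (add_nonneg (trap_nonneg u) (drift_nonneg α t u))
  simp only [fieldFun, min_eq_right ht, max_eq_left ht, max_eq_right hu.le,
    max_eq_left (neg_nonneg.2 hu.le), branching_zero]
  linarith

/-- A solution does not stay below `0`: as long as it does, `√(-φ) + t²` decreases. -/
theorem exists_nonneg {α : ℕ × ℕ → Fin 2} {φ : ℝ → ℝ}
    (hφ : ∀ t, HasDerivAt φ (field α (t, φ t)) t) : ∃ T, 0 ≤ T ∧ 0 ≤ φ T := by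
  by_contra! h
  have hd : ∀ t, 0 ≤ t →
      HasDerivAt (fun t => √(-φ t) + t ^ 2)
        (-field α (t, φ t) / (2 * √(-φ t)) + 2 * t) t := by
    intro t ht
    have h1 := ((hφ t).neg.sqrt (by simpa using (h t ht).ne)).fun_add (hasDerivAt_pow 2 t)
    simpa using h1
  have hanti : AntitoneOn (fun t => √(-φ t) + t ^ 2) (Set.Ici 0) := by
    refine antitoneOn_of_deriv_nonpos (convex_Ici 0)
      (fun t ht => (hd t ht).continuousAt.continuousWithinAt)
      (fun t ht => ?_) fun t ht => ?_
    · rw [interior_Ici] at ht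
      exact (hd t (le_of_lt ht)).differentiableAt.differentiableWithinAt
    · rw [interior_Ici] at ht
      have ht' : 0 ≤ t := le_of_lt ht
      rw [(hd t ht').deriv]
      have hs : 0 < √(-φ t) := sqrt_pos.2 (neg_pos.2 (h t ht'))
      have := fieldFun_of_neg (α := α) ht' (h t ht')
      rw [field_apply, neg_div]
      have : 2 * t ≤ fieldFun α t (φ t) / (2 * √(-φ t)) := by
        rw [le_div_iff₀ (by positivity)]
        linarith
      linarith
  set c := √(-φ 0) with hc
  have hc0 : 0 ≤ c := sqrt_nonneg _
  have := hanti (Set.mem_Ici.2 le_rfl) (Set.mem_Ici.2 (by linarith : (0 : ℝ) ≤ c + 1))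
    (by linarith)
  have h2 : 0 ≤ √(-φ (c + 1)) := sqrt_nonneg _
  simp only [← hc] at this
  nlinarith

theorem nonneg_of_nonneg {α : ℕ × ℕ → Fin 2} {φ : ℝ → ℝ}
    (hφ : ∀ t, HasDerivAt φ (field α (t, φ t)) t) {T t : ℝ} (hT : 0 ≤ T) (h0 : 0 ≤ φ T)
    (ht : T ≤ t) : 0 ≤ φ t := by
  have hcont : Continuous φ := continuous_iff_continuousAt.2 fun s => (hφ s).continuousAt
  by_contra! hneg
  -- `s` is the last time before `t` at which `φ` is nonnegative.
  obtain ⟨s, ⟨hs, hs0⟩, hsmax⟩ :=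
    (isCompact_Icc.inter_right (isClosed_le continuous_const hcont) :
      IsCompact (Set.Icc T t ∩ {s | 0 ≤ φ s})).exists_isGreatest ⟨T, ⟨le_rfl, ht⟩, h0⟩
  have hst : s < t := lt_of_le_of_ne hs.2 fun h => by
    rw [h] at hs0; exact absurd hs0 (not_le.2 hneg)
  obtain ⟨c, hc, hceq⟩ := exists_hasDerivAt_eq_slope φ _ hst hcont.continuousOn
    fun x _ => hφ x
  have hcneg : φ c < 0 := by
    by_contra! hc0
    exact absurd (hsmax ⟨⟨hs.1.trans hc.1.le, hc.2.le⟩, hc0⟩) (not_le.2 hc.1)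
  have hc0 : 0 ≤ c := hT.trans (hs.1.trans hc.1.le)
  have h1 := fieldFun_of_neg (α := α) hc0 hcneg
  have h2 : 0 ≤ 4 * c * √(-φ c) := by positivity
  rw [field_apply] at hceq
  have h3 : (φ t - φ s) / (t - s) < 0 :=
    div_neg_of_neg_of_pos (by linarith [show 0 ≤ φ s from hs0]) (by linarith)
  linarith

theorem two_mul_min_le_sin {x : ℝ} (h0 : 0 ≤ x) (h1 : x ≤ 1) : 2 * min x (1 - x) ≤ sin (π * x) := by
  have key : ∀ {y : ℝ}, 0 ≤ y → y ≤ 1 / 2 → 2 * y ≤ sin (π * y) := by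
    intro y hy hy'
    have := mul_le_sin (x := π * y) (by positivity) (by nlinarith [pi_pos])
    calc 2 * y = 2 / π * (π * y) := by field_simp
      _ ≤ _ := this
  rcases le_total x (1 / 2) with h | h
  · rw [min_eq_left (by linarith)]
    exact key h0 h
  · rw [min_eq_right (by linarith), ← sin_pi_sub, show π - π * x = π * (1 - x) by ring]
    exact key (by linarith) (by linarith)

theorem inv_sqrt_sin_le {x : ℝ} (h0 : 0 < x) (h1 : x < 1) :
    (√(sin (π * x)))⁻¹ ≤ x ^ (-(1 / 2) : ℝ) + (1 - x) ^ (-(1 / 2) : ℝ) := by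
  have h2 : 0 < 1 - x := by linarith
  have hm := two_mul_min_le_sin h0.le h1.le
  rw [rpow_neg h0.le, rpow_neg h2.le, ← sqrt_eq_rpow, ← sqrt_eq_rpow]
  have hx : 0 < √x := sqrt_pos.2 h0
  have hx' : 0 < √(1 - x) := sqrt_pos.2 h2
  rcases le_total x (1 - x) with h | h
  · rw [min_eq_left h] at hm
    have : (√(sin (π * x)))⁻¹ ≤ (√x)⁻¹ := by gcongr; linarith
    linarith [inv_pos.2 hx']
  · rw [min_eq_right h] at hm
    have : (√(sin (π * x)))⁻¹ ≤ (√(1 - x))⁻¹ := by gcongr; linarith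
    linarith [inv_pos.2 hx]

theorem intervalIntegrable_bound (a : ℝ) : IntervalIntegrable
    (fun x : ℝ => (x - a) ^ (-(1 / 2) : ℝ) + (1 - (x - a)) ^ (-(1 / 2) : ℝ)) volume a (a + 1) := by
  have h : IntervalIntegrable (fun x : ℝ => x ^ (-(1 / 2) : ℝ)) volume 0 1 :=
    intervalIntegral.intervalIntegrable_rpow' (by norm_num)
  have h' := (h.comp_sub_left 1).symm
  simp only [sub_zero, sub_self] at h'
  have := (h.add h').comp_sub_right a
  simpa [add_comm] using this

theorem integral_bound (a : ℝ) :
    ∫ x in a..(a + 1), ((x - a) ^ (-(1 / 2) : ℝ) + (1 - (x - a)) ^ (-(1 / 2) : ℝ)) = 4 := by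
  have h : IntervalIntegrable (fun x : ℝ => x ^ (-(1 / 2) : ℝ)) volume 0 1 :=
    intervalIntegral.intervalIntegrable_rpow' (by norm_num)
  have h' := (h.comp_sub_left 1).symm
  simp only [sub_zero, sub_self] at h'
  have hi : ∫ x : ℝ in (0 : ℝ)..1, x ^ (-(1 / 2) : ℝ) = 2 := by
    rw [integral_rpow (Or.inl (by norm_num))]
    norm_num
  rw [intervalIntegral.integral_comp_sub_right
      (fun x : ℝ => x ^ (-(1 / 2) : ℝ) + (1 - x) ^ (-(1 / 2) : ℝ)) a,
    sub_self, add_sub_cancel_left, intervalIntegral.integral_add h h',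
    intervalIntegral.integral_comp_sub_left (fun x : ℝ => x ^ (-(1 / 2) : ℝ)) 1, sub_self, sub_zero,
    hi]
  norm_num

theorem inv_le_of_trap_le {M : ℕ} {w y : ℝ} (h0 : (M : ℝ) < w) (h1 : w < M + 1)
    (hy : trap w ≤ y) :
    y⁻¹ ≤ (1 / 5) * (1 / 2) ^ M *
      ((w - M) ^ (-(1 / 2) : ℝ) + (1 - (w - M)) ^ (-(1 / 2) : ℝ)) := by
  have hM : (0 : ℝ) ≤ M := Nat.cast_nonneg M
  have hx0 : 0 < w - M := by linarith
  have hx1 : w - M < 1 := by linarith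
  have hsin : |sin (π * max w 0)| = sin (π * (w - M)) := by
    rw [max_eq_left (by linarith), show π * w = π * (w - M) + M * π by ring, sin_add_nat_mul_pi,
      abs_mul, abs_pow, abs_neg, abs_one, one_pow, one_mul, abs_of_nonneg]
    exact sin_nonneg_of_nonneg_of_le_pi (by positivity) (by nlinarith [pi_pos])
  have hpos : 0 < sin (π * (w - M)) :=
    lt_of_lt_of_le (mul_pos two_pos (lt_min hx0 (by linarith))) (two_mul_min_le_sin hx0.le hx1.le)
  have hpow : (2 : ℝ) ^ M ≤ 2 ^ w := by
    rw [← rpow_natCast]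
    exact rpow_le_rpow_of_exponent_le one_le_two h0.le
  have hle : 5 * 2 ^ M * √(sin (π * (w - M))) ≤ y := by
    refine le_trans ?_ hy
    rw [trap, hsin]
    gcongr
  calc y⁻¹ ≤ (5 * 2 ^ M * √(sin (π * (w - M))))⁻¹ := by
        have := sqrt_pos.2 hpos
        gcongr
    _ = (1 / 5) * (1 / 2) ^ M * (√(sin (π * (w - M))))⁻¹ := by
        rw [mul_inv, mul_inv, one_div, one_div, inv_pow]
    _ ≤ _ := by
        gcongr
        exact inv_sqrt_sin_le hx0 hx1

/-- The time that a solution of `u' = g u` takes to reach any height from `0` is at most `8 / 5`. -/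
theorem integral_inv_le {g : ℝ → ℝ} (hg : Continuous g) (hpos : ∀ w, 0 < g w)
    (htrap : ∀ w, 0 ≤ w → trap w ≤ g w) (x : ℝ) : ∫ w in (0 : ℝ)..x, (g w)⁻¹ ≤ 8 / 5 := by
  have hcont : Continuous fun w => (g w)⁻¹ := hg.inv₀ fun w => (hpos w).ne'
  have hint : ∀ a b, IntervalIntegrable (fun w => (g w)⁻¹) volume a b :=
    fun a b => hcont.intervalIntegrable a b
  obtain ⟨K, hK⟩ := exists_nat_ge x
  have hnn : ∀ w, 0 ≤ (g w)⁻¹ := fun w => (inv_pos.2 (hpos w)).le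
  calc ∫ w in (0 : ℝ)..x, (g w)⁻¹ ≤ ∫ w in (0 : ℝ)..(K : ℝ), (g w)⁻¹ := by
        rw [← intervalIntegral.integral_add_adjacent_intervals (hint 0 x) (hint x K)]
        linarith [intervalIntegral.integral_nonneg (μ := volume) hK fun w _ => hnn w]
    _ = ∑ M ∈ Finset.range K, ∫ w in ((M : ℕ) : ℝ)..((M + 1 : ℕ) : ℝ), (g w)⁻¹ := by
        rw [intervalIntegral.sum_integral_adjacent_intervals (a := fun k : ℕ => (k : ℝ))
          fun k _ => hint _ _, Nat.cast_zero]
    _ ≤ ∑ M ∈ Finset.range K, (4 / 5) * (1 / 2 : ℝ) ^ M := by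
        refine Finset.sum_le_sum fun M _ => ?_
        push_cast
        calc ∫ w in (M : ℝ)..(M + 1), (g w)⁻¹
            ≤ ∫ w in (M : ℝ)..(M + 1), (1 / 5) * (1 / 2) ^ M *
                ((w - M) ^ (-(1 / 2) : ℝ) + (1 - (w - M)) ^ (-(1 / 2) : ℝ)) := by
              refine intervalIntegral.integral_mono_on_of_le_Ioo (by linarith) (hint _ _)
                ((intervalIntegrable_bound M).const_mul _) fun w hw => ?_
              exact inv_le_of_trap_le hw.1 hw.2
                (htrap w ((Nat.cast_nonneg M).trans hw.1.le))
          _ = (4 / 5) * (1 / 2 : ℝ) ^ M := by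
              rw [intervalIntegral.integral_const_mul, integral_bound]
              ring
    _ = (4 / 5) * ∑ M ∈ Finset.range K, (1 / 2 : ℝ) ^ M := by rw [Finset.mul_sum]
    _ ≤ 8 / 5 := by linarith [sum_geometric_two_le K]

theorem fieldFun_of_window {α : ℕ × ℕ → Fin 2} {n : ℕ} {t u : ℝ}
    (ht : t ∈ Set.Icc (2 * n * π + π / 2) (2 * n * π + 3 * π / 2)) (hu : 0 ≤ u) :
    fieldFun α t u = -cos t * (trap u + drift α ((2 * n + 1) * π) u) := by
  have ht0 : 0 ≤ t := le_trans (by positivity) ht.1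
  have hcos : cos t ≤ 0 := by
    rw [← cos_sub_nat_mul_two_pi t n]
    exact cos_nonpos_of_pi_div_two_le_of_le (by linarith [ht.1]) (by linarith [ht.2])
  have habs : |t - (2 * n + 1) * π| ≤ π / 2 := by
    rw [abs_le]; constructor <;> linarith [ht.1, ht.2]
  have hdrift : drift α t u = drift α ((2 * n + 1) * π) u := by
    refine tsum_congr fun p => ?_
    rw [driftTerm, driftTerm, window_eq_ite habs, window_eq_ite (n := n)]
    rw [sub_self, abs_zero]
    positivity
  rw [fieldFun, min_eq_right ht0, max_eq_right (neg_nonpos.2 hu), max_eq_right hcos,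
    max_eq_left (neg_nonneg.2 hcos), hdrift]
  simp

/-- If infinitely many bits of the `n`-th row are `1`, then no height is at rest in the `n`-th
window, and no solution survives: `Φ u = ∫₀ᵘ dw / g w` would have to increase by
`∫ -cos = 2` along it. -/
theorem eventually_eq_zero_of_nonneg {α : ℕ × ℕ → Fin 2} {φ : ℝ → ℝ}
    (hφ : ∀ t, HasDerivAt φ (field α (t, φ t)) t) {n : ℕ}
    (h0 : ∀ t, 2 * n * π ≤ t → 0 ≤ φ t) : ∀ᶠ m in atTop, α (n, m) = 0 := by
  by_contra hbits
  rw [not_eventually] at hbits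
  set g : ℝ → ℝ := fun w => trap (max w 0) + drift α ((2 * n + 1) * π) (max w 0) with hgdef
  have hg : Continuous g := by
    have h1 := continuous_trap
    have h2 : Continuous fun u => drift α ((2 * n + 1) * π) u :=
      continuous_drift.comp (f := fun u : ℝ => (α, (2 * n + 1) * π, u)) (by fun_prop)
    fun_prop
  have hpos : ∀ w, 0 < g w := by
    intro w
    obtain ⟨m₀, hm₀⟩ := exists_nat_ge (max w 0)
    obtain ⟨m, hm, hα⟩ := frequently_atTop.1 hbits m₀
    refine add_pos_of_nonneg_of_pos (trap_nonneg _) ?_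
    refine (summable_driftTerm _ _ _).tsum_pos (driftTerm_nonneg _ _ _) (n, m) ?_
    have hα1 : (0 : ℝ) < (α (n, m) : ℕ) :=
      Nat.cast_pos.2 (Nat.pos_of_ne_zero fun h => hα (Fin.ext h))
    have hw : window n ((2 * n + 1) * π) = 1 := window_eq_one (by
      rw [sub_self, abs_zero]; positivity)
    have hc : 0 < cutoff m (max w 0) :=
      cutoff_pos (le_max_right _ _) (hm₀.trans (by exact_mod_cast hm))
    simp only [driftTerm, hw]
    positivity
  have htrap : ∀ w, 0 ≤ w → trap w ≤ g w := by
    intro w hw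
    simp only [hgdef, max_eq_left hw]
    linarith [drift_nonneg α ((2 * n + 1) * π) w]
  have hcont : Continuous fun w => (g w)⁻¹ := hg.inv₀ fun w => (hpos w).ne'
  set Φ : ℝ → ℝ := fun x => ∫ w in (0 : ℝ)..x, (g w)⁻¹ with hΦ
  have hΦd : ∀ x, HasDerivAt Φ (g x)⁻¹ x := fun x =>
    intervalIntegral.integral_hasDerivAt_right (hcont.intervalIntegrable _ _)
      (hcont.stronglyMeasurableAtFilter _ _) hcont.continuousAt
  set a : ℝ := 2 * n * π + π / 2 with ha
  set b : ℝ := 2 * n * π + 3 * π / 2 with hb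
  have hab : a ≤ b := by linarith [pi_pos]
  have hderiv : ∀ t ∈ Set.Icc a b, HasDerivAt (fun t => Φ (φ t) + sin t) 0 t := by
    intro t ht
    have ht0 : 0 ≤ φ t := h0 t (by linarith [ht.1, pi_pos])
    refine (((hΦd (φ t)).comp t (hφ t)).add (hasDerivAt_sin t)).congr_deriv ?_
    rw [field_apply, fieldFun_of_window ht ht0]
    have h2 : g (φ t) = trap (φ t) + drift α ((2 * n + 1) * π) (φ t) := by
      simp only [hgdef, max_eq_left ht0]
    rw [← h2]
    field_simp [(hpos (φ t)).ne']
    ring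
  have hconst := constant_of_derivWithin_zero (f := fun t => Φ (φ t) + sin t) (a := a) (b := b)
    (fun t ht => (hderiv t ht).differentiableAt.differentiableWithinAt)
    (fun t ht => ((hderiv t (Set.Ico_subset_Icc_self ht)).hasDerivWithinAt.derivWithin
      (uniqueDiffOn_Icc (by linarith [pi_pos]) t (Set.Ico_subset_Icc_self ht)))) b
    (Set.right_mem_Icc.2 hab)
  have hsa : sin a = 1 := by
    rw [← sin_sub_nat_mul_two_pi a n, show a - n * (2 * π) = π / 2 by rw [ha]; ring, sin_pi_div_two]
  have hsb : sin b = -1 := by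
    rw [← sin_sub_nat_mul_two_pi b n, show b - n * (2 * π) = π / 2 + π by rw [hb]; ring, sin_add_pi,
      sin_pi_div_two]
  have hΦa : 0 ≤ Φ (φ a) :=
    intervalIntegral.integral_nonneg (h0 a (by linarith [pi_pos])) fun w _ => (inv_pos.2 (hpos w)).le
  have hΦb : Φ (φ b) ≤ 8 / 5 := integral_inv_le hg hpos htrap _
  simp only [hsa, hsb] at hconst
  linarith

end GlobalCauchy

/-! ### Explicit global solutions -/

namespace GlobalCauchy

open Real

theorem hasDerivAt_comp_max_zero {g : ℝ → ℝ} {g' x : ℝ} (hg : HasDerivAt g g' (max x 0))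
    (h0 : x ≤ 0 → g' = 0) : HasDerivAt (fun y => g (max y 0)) g' x := by
  rcases lt_trichotomy x 0 with hx | rfl | hx
  · rw [h0 hx.le]
    refine (hasDerivAt_const x (g 0)).congr_of_eventuallyEq ?_
    filter_upwards [gt_mem_nhds hx] with y hy
    rw [max_eq_right (le_of_lt hy)]
  · rw [max_self] at hg
    rw [h0 le_rfl] at hg ⊢
    rw [← hasDerivWithinAt_univ, ← Set.Iic_union_Ici (a := (0 : ℝ))]
    refine HasDerivWithinAt.union ?_ ?_
    · exact (hasDerivWithinAt_const _ _ (g 0)).congr (fun y hy => by rw [max_eq_right hy])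
        (by rw [max_self])
    · exact hg.hasDerivWithinAt.congr (fun y hy => by rw [max_eq_left hy]) (by rw [max_self])
  · rw [max_eq_left hx.le] at hg
    refine hg.congr_of_eventuallyEq ?_
    filter_upwards [lt_mem_nhds hx] with y hy
    rw [max_eq_left (le_of_lt hy)]

/-- The solution of `x' = branching x` which is `0` up to time `0` and `tan²` on `[0, π/2)`. -/
noncomputable def tanSq (x : ℝ) : ℝ := tan (max x 0) ^ 2

theorem tanSq_nonneg (x : ℝ) : 0 ≤ tanSq x := sq_nonneg _

theorem tanSq_of_nonpos {x : ℝ} (h : x ≤ 0) : tanSq x = 0 := by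
  simp [tanSq, max_eq_right h]

theorem hasDerivAt_tanSq {x : ℝ} (hx : x < π / 2) : HasDerivAt tanSq (branching (tanSq x)) x := by
  have hm : max x 0 < π / 2 := max_lt hx (by positivity)
  have htan : 0 ≤ tan (max x 0) :=
    tan_nonneg_of_nonneg_of_le_pi_div_two (le_max_right _ _) hm.le
  have hcos : 0 < cos (max x 0) :=
    cos_pos_of_mem_Ioo ⟨by linarith [le_max_right x 0, pi_pos], hm⟩
  have h := (hasDerivAt_tan hcos.ne').fun_pow 2
  refine (hasDerivAt_comp_max_zero h fun h0 => ?_).congr_deriv ?_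
  · simp [max_eq_right h0]
  · rw [tanSq, branching, sqrt_sq htan, ← inv_one_add_tan_sq hcos.ne', one_div, inv_inv]
    push_cast
    ring

/-- The internal clock of the upper half-plane: it runs from `0` to `1/2`, stops while `cos t ≤ 0`,
and runs back to `0` in each period. -/
noncomputable def clock (t : ℝ) : ℝ := (1 - max (cos t) 0 ^ 2) / 2

theorem hasDerivAt_clock (t : ℝ) : HasDerivAt clock (max (cos t) 0 * sin t) t := by
  have h1 : HasDerivAt (fun x : ℝ => max x 0 ^ 2) (2 * max (cos t) 0) (cos t) := by
    refine hasDerivAt_comp_max_zero (g := fun x => x ^ 2) ?_ fun h => ?_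
    · simpa using hasDerivAt_pow 2 (max (cos t) 0)
    · simp [max_eq_right h]
  refine (((h1.comp t (hasDerivAt_cos t)).const_sub 1).div_const 2).congr_deriv ?_
  ring

theorem clock_le (t : ℝ) : clock t ≤ 1 / 2 := by
  unfold clock
  linarith [sq_nonneg (max (cos t) 0)]

theorem clock_eq_half {t : ℝ} (h : cos t ≤ 0) : clock t = 1 / 2 := by
  simp [clock, max_eq_right h]

/-- The clock time at which a solution has to leave `0` in order to rest at the height `M`. -/
noncomputable def departure (M : ℕ) : ℝ := 1 / 2 - arctan √M / π

theorem departure_pos (M : ℕ) : 0 < departure M := by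
  have h := arctan_lt_pi_div_two √M
  rw [departure, sub_pos, div_lt_iff₀ pi_pos]
  linarith

/-- The solution that rises from `0` to the height `M`, rests there and returns, in each period. -/
noncomputable def excursion (M : ℕ) (t : ℝ) : ℝ := tanSq (π * (clock t - departure M))

theorem hasDerivAt_excursion (M : ℕ) (t : ℝ) : HasDerivAt (excursion M)
    (π * (max (cos t) 0 * sin t) * branching (excursion M t)) t := by
  have hlt : π * (clock t - departure M) < π / 2 := by
    have := mul_lt_mul_of_pos_left
      (show clock t - departure M < 1 / 2 by linarith [clock_le t, departure_pos M]) pi_pos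
    linarith
  refine ((hasDerivAt_tanSq hlt).comp t
    (((hasDerivAt_clock t).sub_const (departure M)).const_mul π)).congr_deriv ?_
  rw [excursion]
  ring

theorem excursion_of_cos_nonpos (M : ℕ) {t : ℝ} (h : cos t ≤ 0) : excursion M t = M := by
  have hpi := pi_pos.ne'
  rw [excursion, clock_eq_half h, departure,
    show π * (1 / 2 - (1 / 2 - arctan √M / π)) = arctan √M by field_simp; ring, tanSq,
    max_eq_left (arctan_nonneg.2 (sqrt_nonneg _)), tan_arctan, sq_sqrt (Nat.cast_nonneg M)]

theorem excursion_of_clock_le {M : ℕ} {t : ℝ} (h : clock t ≤ departure M) : excursion M t = 0 :=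
  tanSq_of_nonpos (mul_nonpos_of_nonneg_of_nonpos pi_pos.le (by linarith))

theorem excursion_zero (t : ℝ) : excursion 0 t = 0 :=
  excursion_of_clock_le ((clock_le t).trans (by simp [departure]))

/-- The part of a global solution in the upper half-plane: in the `n`-th period it makes an
excursion to the height `M n`. -/
noncomputable def upper (M : ℕ → ℕ) (t : ℝ) : ℝ := excursion (M ⌊t / (2 * π)⌋₊) t

theorem upper_nonneg (M : ℕ → ℕ) (t : ℝ) : 0 ≤ upper M t := tanSq_nonneg _

theorem hasDerivAt_upper (M : ℕ → ℕ) (t : ℝ) : HasDerivAt (upper M)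
    (π * (max (cos t) 0 * sin t) * branching (upper M t)) t := by
  have hquot : ContinuousAt (fun t : ℝ => t / (2 * π)) t := by fun_prop
  by_cases hcos : cos t = 1
  · -- Excursions to different heights meet here, but all of them vanish nearby.
    have hclock : clock t = 0 := by simp [clock, hcos]
    have h1 : ∀ᶠ t' in 𝓝 t, t' / (2 * π) < (⌊t / (2 * π)⌋₊ : ℝ) + 1 :=
      hquot.eventually_lt_const (Nat.lt_floor_add_one _)
    have h2 : ∀ᶠ t' in 𝓝 t, ∀ i ∈ Finset.range (⌊t / (2 * π)⌋₊ + 1), clock t' < departure (M i) := by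
      rw [Filter.eventually_all_finset]
      intro i _
      exact (hasDerivAt_clock t).continuousAt.eventually_lt_const (hclock ▸ departure_pos _)
    have h3 : upper M =ᶠ[𝓝 t] fun _ => 0 := by
      filter_upwards [h1, h2] with t' h1 h2
      refine excursion_of_clock_le (h2 _ (Finset.mem_range.2 ?_)).le
      rw [Nat.floor_lt' (Nat.succ_ne_zero _)]
      exact_mod_cast h1
    rw [h3.eq_of_nhds, branching_zero, mul_zero]
    exact (hasDerivAt_const t 0).congr_of_eventuallyEq h3
  · have hfloor : ∀ᶠ t' in 𝓝 t, ⌊t' / (2 * π)⌋₊ = ⌊t / (2 * π)⌋₊ := by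
      rcases lt_or_ge t 0 with ht | ht
      · filter_upwards [gt_mem_nhds ht] with t' ht'
        rw [Nat.floor_of_nonpos (div_nonpos_of_nonpos_of_nonneg ht.le two_pi_pos.le),
          Nat.floor_of_nonpos (div_nonpos_of_nonpos_of_nonneg (le_of_lt ht') two_pi_pos.le)]
      · have h1 := Nat.floor_le (div_nonneg ht two_pi_pos.le)
        have h2 : (⌊t / (2 * π)⌋₊ : ℝ) ≠ t / (2 * π) := by
          intro h
          refine hcos ?_
          rw [eq_div_iff two_pi_pos.ne'] at h
          rw [← h, cos_nat_mul_two_pi]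
        filter_upwards [hquot.eventually_const_lt (lt_of_le_of_ne h1 h2),
          hquot.eventually_lt_const (Nat.lt_floor_add_one (t / (2 * π)))] with t' h3 h4
        exact Nat.floor_eq_on_Ico _ _ ⟨h3.le, h4⟩
    refine (hasDerivAt_excursion _ t).congr_of_eventuallyEq ?_
    filter_upwards [hfloor] with t' ht'
    rw [upper, ht']

/-- The part of a global solution in the lower half-plane: it leaves `0` after time `-1`, has the
value `-s²` at time `0`, and is back at `0` at time `√s`. -/
noncomputable def lower (s t : ℝ) : ℝ :=
  if t ≤ 0 then -tanSq (arctan s - 2 * t ^ 2) else -max (s - t ^ 2) 0 ^ 2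

theorem lower_nonpos (s t : ℝ) : lower s t ≤ 0 := by
  unfold lower
  split_ifs
  · exact neg_nonpos.2 (tanSq_nonneg _)
  · exact neg_nonpos.2 (sq_nonneg _)

theorem lower_neg_one (s : ℝ) : lower s (-1) = 0 := by
  rw [lower, if_pos (by norm_num), tanSq_of_nonpos, neg_zero]
  linarith [arctan_lt_pi_div_two s, pi_lt_four]

theorem lower_eq_of_nonneg {s t : ℝ} (hs : 0 ≤ s) (ht : 0 ≤ t) :
    lower s t = -max (s - t ^ 2) 0 ^ 2 := by
  rcases ht.eq_or_lt with rfl | ht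
  · simp [lower, tanSq, max_eq_left (arctan_nonneg.2 hs), max_eq_left hs, tan_arctan]
  · rw [lower, if_neg (not_le.2 ht)]

theorem hasDerivAt_lower {s : ℝ} (hs : 0 ≤ s) (t : ℝ) : HasDerivAt (lower s)
    (4 * min t 0 * branching (-lower s t) + 4 * max t 0 * √(-lower s t)) t := by
  have hneg : ∀ t ≤ 0, HasDerivAt (fun t => -tanSq (arctan s - 2 * t ^ 2))
      (4 * min t 0 * branching (-lower s t) + 4 * max t 0 * √(-lower s t)) t := by
    intro t ht
    have hlt : arctan s - 2 * t ^ 2 < π / 2 := by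
      linarith [arctan_lt_pi_div_two s, sq_nonneg t]
    have h1 : HasDerivAt (fun t : ℝ => arctan s - 2 * t ^ 2) (-(2 * (2 * t))) t := by
      simpa using ((hasDerivAt_pow 2 t).const_mul 2).const_sub (arctan s)
    refine ((hasDerivAt_tanSq hlt).comp t h1).neg.congr_deriv ?_
    rw [lower, if_pos ht, neg_neg, min_eq_left ht, max_eq_right ht]
    ring
  have hpos : ∀ t, 0 ≤ t → HasDerivAt (fun t => -max (s - t ^ 2) 0 ^ 2)
      (4 * min t 0 * branching (-lower s t) + 4 * max t 0 * √(-lower s t)) t := by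
    intro t ht
    have h1 : HasDerivAt (fun t : ℝ => s - t ^ 2) (-(2 * t)) t := by
      simpa using (hasDerivAt_pow 2 t).const_sub s
    have h2 : HasDerivAt (fun x : ℝ => max x 0 ^ 2) (2 * max (s - t ^ 2) 0) (s - t ^ 2) := by
      refine hasDerivAt_comp_max_zero (g := fun x => x ^ 2) ?_ fun h => ?_
      · simpa using hasDerivAt_pow 2 (max (s - t ^ 2) 0)
      · simp [max_eq_right h]
    refine (h2.comp t h1).neg.congr_deriv ?_
    rw [lower_eq_of_nonneg hs ht, neg_neg, min_eq_right ht, max_eq_left ht,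
      sqrt_sq (le_max_right _ _)]
    ring
  rcases lt_trichotomy t 0 with ht | rfl | ht
  · refine (hneg t ht.le).congr_of_eventuallyEq ?_
    filter_upwards [gt_mem_nhds ht] with y hy
    rw [lower, if_pos (le_of_lt hy)]
  · rw [← hasDerivWithinAt_univ, ← Set.Iic_union_Ici (a := (0 : ℝ))]
    refine HasDerivWithinAt.union ?_ ?_
    · exact (hneg 0 le_rfl).hasDerivWithinAt.congr (fun y hy => if_pos hy) (if_pos le_rfl)
    · exact (hpos 0 le_rfl).hasDerivWithinAt.congr (fun y hy => lower_eq_of_nonneg hs hy)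
        (lower_eq_of_nonneg hs le_rfl)
  · refine (hpos t ht.le).congr_of_eventuallyEq ?_
    filter_upwards [lt_mem_nhds ht] with y hy
    rw [lower_eq_of_nonneg hs (le_of_lt hy)]

theorem trap_of_nonpos {u : ℝ} (h : u ≤ 0) : trap u = 0 := by simp [trap, max_eq_right h]

theorem trap_natCast (M : ℕ) : trap M = 0 := by
  simp [trap, mul_comm π]

theorem drift_of_nonpos (α : ℕ × ℕ → Fin 2) {t : ℝ} (ht : t ≤ 0) (u : ℝ) : drift α t u = 0 := by
  simp [drift, driftTerm, window_eq_zero_of_nonpos ht]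

theorem drift_of_le_neg_one (α : ℕ × ℕ → Fin 2) (t : ℝ) {u : ℝ} (hu : u ≤ -1) :
    drift α t u = 0 := by
  simp [drift, driftTerm, cutoff_eq_zero_of_le_neg_one hu]

theorem drift_of_window {α : ℕ × ℕ → Fin 2} {n M : ℕ} {t : ℝ}
    (ht : |t - (2 * n + 1) * π| ≤ π / 2) (hα : ∀ m, M ≤ m → α (n, m) = 0) :
    drift α t M = 0 := by
  refine (tsum_congr fun p => ?_).trans tsum_zero
  obtain ⟨k, m⟩ := p
  rw [driftTerm, window_eq_ite ht]
  split_ifs with hk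
  · obtain rfl : k = n := hk
    rcases le_or_gt M m with hm | hm
    · simp [hα m hm]
    · rw [cutoff_eq_zero_of_le (m := m) (by exact_mod_cast hm)]
      simp
  · simp

theorem exists_isGlobalSolution {α : ℕ × ℕ → Fin 2}
    (hα : ∀ᶠ n in atTop, ∀ᶠ m in atTop, α (n, m) = 0) :
    ∃ φ, IsGlobalSolution (field α) (-1) 0 φ := by
  obtain ⟨N₀, hN₀⟩ := eventually_atTop.1 hα
  set N := max N₀ 1 with hNdef
  have hN1 : (1 : ℝ) ≤ N := by exact_mod_cast le_max_right N₀ 1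
  have hex : ∀ n, ∃ M, (N ≤ n → ∀ m, M ≤ m → α (n, m) = 0) ∧ (n < N → M = 0) := by
    intro n
    rcases le_or_gt N n with h | h
    · obtain ⟨M, hM⟩ := eventually_atTop.1 (hN₀ n ((le_max_left _ _).trans h))
      exact ⟨M, fun _ => hM, fun h' => absurd h' (not_lt.2 h)⟩
    · exact ⟨0, fun h' => absurd h' (not_le.2 h), fun _ => rfl⟩
  choose M hMα hM0 using hex
  -- The lower part of the solution is back at `0` at the start of the `N`-th period.
  set τ : ℝ := 2 * π * N with hτ
  have hτ0 : 0 < τ := by positivity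
  have hs : 0 ≤ τ ^ 2 := sq_nonneg _
  have hup : ∀ t < τ, upper M t = 0 := by
    intro t ht
    rw [upper, hM0, excursion_zero]
    have : t / (2 * π) < N := by rw [div_lt_iff₀ two_pi_pos]; linarith
    rwa [Nat.floor_lt' (by omega)]
  have hlow : ∀ t, τ ≤ t → lower (τ ^ 2) t = 0 := by
    intro t ht
    rw [lower_eq_of_nonneg hs (hτ0.le.trans ht), max_eq_right (by nlinarith)]
    simp
  have hmax : ∀ t, max (-(lower (τ ^ 2) t + upper M t)) 0 = -lower (τ ^ 2) t ∧
      max (lower (τ ^ 2) t + upper M t) 0 = upper M t := by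
    intro t
    rcases lt_or_ge t τ with h | h
    · have := lower_nonpos (τ ^ 2) t
      rw [hup t h, add_zero, max_eq_left (by linarith), max_eq_right this]
      exact ⟨rfl, rfl⟩
    · have := upper_nonneg M t
      rw [hlow t h, zero_add, max_eq_right (by linarith), max_eq_left this, neg_zero]
      exact ⟨rfl, rfl⟩
  have hrest : ∀ t, max (-cos t) 0 *
      (trap (lower (τ ^ 2) t + upper M t) + drift α t (lower (τ ^ 2) t + upper M t)) = 0 := by
    intro t
    rcases le_or_gt 0 (cos t) with hcos | hcos
    · rw [max_eq_right (by linarith), zero_mul]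
    refine mul_eq_zero_of_right _ ?_
    rcases lt_or_ge t τ with h | h
    · rw [hup t h, add_zero, trap_of_nonpos (lower_nonpos _ _), zero_add]
      rcases le_or_gt t 0 with ht | ht
      · exact drift_of_nonpos _ ht _
      · -- Since `cos t < 0`, `t` is not in the quarter period before `τ`, outside of which
        -- the height is at most `-1`.
        have htτ : t < τ - π / 2 := by
          by_contra! h'
          refine absurd hcos (not_lt.2 ?_)
          rw [← cos_sub_nat_mul_two_pi t N]
          exact cos_nonneg_of_neg_pi_div_two_le_of_le (by linarith) (by linarith [pi_pos])
        have h1 : 1 ≤ τ ^ 2 - t ^ 2 := by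
          have h3 := pi_gt_three
          have h4 : 2 * π ≤ τ := by nlinarith
          nlinarith
        refine drift_of_le_neg_one _ _ ?_
        rw [lower_eq_of_nonneg hs ht.le, max_eq_left (by linarith)]
        nlinarith
    · rw [hlow t h, zero_add, upper, excursion_of_cos_nonpos _ hcos.le, trap_natCast, zero_add]
      have ht0 : 0 ≤ t := hτ0.le.trans h
      set n := ⌊t / (2 * π)⌋₊ with hn
      have h1 : n * (2 * π) ≤ t :=
        (le_div_iff₀ two_pi_pos).1 (Nat.floor_le (div_nonneg ht0 two_pi_pos.le))
      have h2 : t < (n + 1) * (2 * π) :=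
        (div_lt_iff₀ two_pi_pos).1 (Nat.lt_floor_add_one (t / (2 * π)))
      have hNn : N ≤ n := by
        refine Nat.le_floor ?_
        rw [le_div_iff₀ two_pi_pos]
        linarith
      refine drift_of_window ?_ (hMα n hNn)
      by_contra! habs
      refine absurd hcos (not_lt.2 ?_)
      rcases lt_abs.1 habs with h3 | h3
      · rw [← cos_sub_nat_mul_two_pi t (n + 1)]
        push_cast
        exact cos_nonneg_of_neg_pi_div_two_le_of_le (by linarith) (by linarith [pi_pos])
      · rw [← cos_sub_nat_mul_two_pi t n]
        exact cos_nonneg_of_neg_pi_div_two_le_of_le (by linarith [pi_pos]) (by linarith)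
  refine ⟨fun t => lower (τ ^ 2) t + upper M t, ?_, fun t => ?_⟩
  · dsimp only
    rw [lower_neg_one, hup _ (by linarith), add_zero]
  · refine ((hasDerivAt_lower hs t).add (hasDerivAt_upper M t)).congr_deriv ?_
    rw [field_apply, fieldFun, hrest, (hmax t).1, (hmax t).2, add_zero]

end GlobalCauchy

/-! ### Hardness -/

namespace GlobalCauchy

theorem field_mem_globalCauchy_iff (α : ℕ × ℕ → Fin 2) :
    (field α, (-1 : ℝ), (0 : ℝ)) ∈ globalCauchy ↔
      ∀ᶠ n : ℕ in atTop, ∀ᶠ m : ℕ in atTop, α (n, m) = 0 := by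
  refine ⟨?_, exists_isGlobalSolution⟩
  rintro ⟨φ, -, hφ⟩
  obtain ⟨T, hT, hφT⟩ := exists_nonneg hφ
  obtain ⟨N, hN⟩ := exists_nat_ge T
  filter_upwards [eventually_ge_atTop N] with n hn
  refine eventually_eq_zero_of_nonneg hφ fun t ht => nonneg_of_nonneg hφ hT hφT (le_trans ?_ ht)
  have h1 : (N : ℝ) ≤ n := by exact_mod_cast hn
  have h2 : (0 : ℝ) ≤ n := Nat.cast_nonneg n
  nlinarith [Real.pi_gt_three]

/-- Translation of a field by the vector `(a, b)`. -/
def translate (a b : ℝ) (F : C(ℝ × ℝ, ℝ)) : C(ℝ × ℝ, ℝ) :=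
  F.comp ⟨fun p => (p.1 - a, p.2 - b), by fun_prop⟩

theorem continuous_translate (a b : ℝ) : Continuous (translate a b) :=
  ContinuousMap.continuous_precomp _

theorem IsGlobalSolution.translate {F : C(ℝ × ℝ, ℝ)} {x y : ℝ} {φ : ℝ → ℝ}
    (h : IsGlobalSolution F x y φ) (a b : ℝ) :
    IsGlobalSolution (translate a b F) (x + a) (y + b) fun t => φ (t - a) + b := by
  refine ⟨by simp [h.1], fun t => ?_⟩
  have h1 := ((h.2 (t - a)).comp_sub_const t a).add_const b
  simpa [GlobalCauchy.translate] using h1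

theorem translate_mem_globalCauchy_iff {F : C(ℝ × ℝ, ℝ)} {x y : ℝ} (a b : ℝ) :
    (translate a b F, x + a, y + b) ∈ globalCauchy ↔ (F, x, y) ∈ globalCauchy := by
  constructor
  · rintro ⟨φ, hφ⟩
    have h := IsGlobalSolution.translate hφ (-a) (-b)
    have hF : translate (-a) (-b) (translate a b F) = F := by
      ext p
      simp [translate]
    simp only [hF, add_neg_cancel_right] at h
    exact ⟨_, h⟩
  · rintro ⟨φ, hφ⟩
    exact ⟨_, IsGlobalSolution.translate hφ a b⟩

end GlobalCauchy

open GlobalCauchy in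
theorem lemma5p7 :
    IsSigma0Hard.{u} 4 globalCauchy ∧
    (∃ F : (ℕ × ℕ → Fin 2) → C(ℝ × ℝ, ℝ), Continuous F ∧
      ∀ α : ℕ × ℕ → Fin 2,
        (F α, (-1 : ℝ), (0 : ℝ)) ∈ globalCauchy ↔
          ∀ᶠ n : ℕ in atTop, ∀ᶠ m : ℕ in atTop, α (n, m) = 0) ∧
    ∀ x y : ℝ, IsSigma0Hard.{u} 4 (globalCauchyAt x y) := by
  refine ⟨?_, ⟨field, field.continuous, field_mem_globalCauchy_iff⟩, ?_⟩
  · intro Y _ _ hY B hB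
    obtain ⟨f, hf, hfB⟩ := hB.exists_continuous_eventually hY
    refine ⟨fun z => (field (f z), -1, 0), by fun_prop, ?_⟩
    ext z
    exact (field_mem_globalCauchy_iff _).trans (hfB z).symm
  · intro x y Y _ _ hY B hB
    obtain ⟨f, hf, hfB⟩ := hB.exists_continuous_eventually hY
    refine ⟨fun z => translate (x + 1) y (field (f z)),
      (continuous_translate _ _).comp (field.continuous.comp hf), ?_⟩
    ext z
    have h := translate_mem_globalCauchy_iff (F := field (f z)) (x := -1) (y := 0) (x + 1) y
    rw [neg_add_cancel_comm_assoc, zero_add] at h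
    exact h.trans ((field_mem_globalCauchy_iff _).trans (hfB z).symm)
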